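/- Let $n\ge 3$ and let $E\subset\mathbb{R}^2$ be the open region enclosed by a simple (not necessarily convex) polygon with vertices $\mathbf{x}_1,\dots,\mathbf{x}_n$. Let $\bar{\mathbf{x}}$ be the centroid of $E$, let $h_E$ be the diameter of the smallest circle enclosing all vertices, and put $\xi=(x_1-\bar x_1)/h_E$, $\eta=(x_2-\bar x_2)/h_E$. Let $$\mathbf{p}_1=\binom10,\quad \mathbf{p}_2=\binom01,\quad \mathbf{p}_3=\binom{-\eta}{\xi},\quad \mathbf{p}_4=\binom{\eta}{\xi},\quad \mathbf{p}_5=\binom{\xi}{0},\quad \mathbf{p}_6=\binom{0}{\eta}$$ be the basis of the vector polynomials of degree at most one; $\mathbf{p}_1,\mathbf{p}_2,\mathbf{p}_3$ are the infinitesimal rigid body motions. Let $\varphi_1,\dots,\varphi_n$ be the scalar virtual element basis functions of order $k=1$ on $E$: each $\varphi_j$ is continuous on $\overline{E}$, affine along every edge, harmonic in $E$, square integrable on $E$ together with its first derivatives, and $\varphi_j(\mathbf{x}_i)=\delta_{ij}$. Put $\boldsymbol{\varphi}_{2j-1}=(\varphi_j,0)^T$ and $\boldsymbol{\varphi}_{2j}=(0,\varphi_j)^T$.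 For a vector field $\mathbf{v}=(v_1,v_2)^T$ let $dof_{2j-1}(\mathbf{v})=v_1(\mathbf{x}_j)$ and $dof_{2j}(\mathbf{v})=v_2(\mathbf{x}_j)$ for $j=1,\dots,n$. Let $\boldsymbol{\epsilon}(\mathbf{v})=(\partial_1v_1,\ \partial_2v_2,\ \partial_2v_1+\partial_1v_2)^T$, let $\mathbf{C}$ be a constant real $3\times3$ matrix (for example the plane stress or plane strain elasticity matrix), and let $$a_E(\mathbf{u},\mathbf{v})=\int_E\boldsymbol{\epsilon}(\mathbf{v})^T\mathbf{C}\,\boldsymbol{\epsilon}(\mathbf{u})\,dE .$$ Define the $2n\times6$ matrix $\mathbf{D}_{i\alpha}=dof_i(\mathbf{p}_\alpha)$, the $6\times 2n$ matrix $$\bar{\mathbf{B}}_{\alpha I}=\begin{cases}\dfrac1n\displaystyle\sum_{i=1}^{2n}dof_i(\boldsymbol{\varphi}_I)\,dof_i(\mathbf{p}_\alpha),&\alpha\le 3,\\[2mm] a_E(\mathbf{p}_\alpha,\boldsymbol{\varphi}_I),&\alpha>3,\end{cases}$$ and the $6\times6$ matrix $$\mathbf{G}_{\alpha\beta}=\begin{cases}\dfrac1n\displaystyle\sum_{i=1}^{2n}dof_i(\mathbf{p}_\alpha)\,dof_i(\mathbf{p}_\beta),&\alpha\le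 3,\\[2mm] a_E(\mathbf{p}_\alpha,\mathbf{p}_\beta),&\alpha>3.\end{cases}$$ Then the integrals $a_E(\mathbf{p}_\alpha,\boldsymbol{\varphi}_I)$ and $a_E(\mathbf{p}_\alpha,\mathbf{p}_\beta)$ converge absolutely for all $\alpha,\beta,I$, and $$\bar{\mathbf{B}}\,\mathbf{D}=\mathbf{G}.$$ -/

import Mathlib

open MeasureTheory Matrix InnerProductSpace

noncomputable section

namespace VEM

/-- The Euclidean plane, with coordinates `x 0` and `x 1`. -/
abbrev Plane : Type := EuclideanSpace ℝ (Fin 2)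

/-- Vector fields (displacement fields) on the plane. -/
abbrev VecField : Type := Plane → Fin 2 → ℝ

/-! ### The polygonal element -/

/-- A simple polygon: at least three vertices, and the closed path that runs through the half-open
edges `[vⱼ, vⱼ₊₁)` one after the other passes through no point twice. Convex and non-convex polygons
are allowed, and so are vertices with a straight angle. -/
structure IsSimple {n : ℕ} (P : Polygon Plane n) : Prop where
  three_le : 3 ≤ n
  injOn : Set.InjOn (fun q : Fin n × ℝ => P.edgePath ℝ q.1 q.2) (Set.univ ×ˢ Set.Ico (0 : ℝ) 1)

/-- The open region `E` enclosed by the polygon: the points off the boundary curve whose connected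
component in the complement of the curve is bounded. -/
def element {n : ℕ} (P : Polygon Plane n) : Set Plane :=
  {x | x ∉ P.boundary ℝ ∧
    Bornology.IsBounded (connectedComponentIn (P.boundary ℝ)ᶜ x)}

/-- The centroid `|E|⁻¹ ∫_E x dx` of the element. -/
def centroid {n : ℕ} (P : Polygon Plane n) : Plane :=
  ⨍ x in element P, x

/-- The diameter `h_E` of the smallest circle that encloses all vertices. -/
def elementDiam {n : ℕ} (P : Polygon Plane n) : ℝ :=
  2 * sInf {r : ℝ | ∃ c : Plane, ∀ j, P.vertices j ∈ Metric.closedBall c r}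

/-! ### Strain and energy -/

/-- The partial derivative `∂_d f`. -/
def partialDeriv (d : Fin 2) (f : Plane → ℝ) (x : Plane) : ℝ :=
  fderiv ℝ f x (EuclideanSpace.single d 1)

/-- The engineering strain `(∂₁ v₁, ∂₂ v₂, ∂₂ v₁ + ∂₁ v₂)` in Voigt notation. -/
def strain (v : VecField) (x : Plane) : Fin 3 → ℝ :=
  ![partialDeriv 0 (fun y => v y 0) x,
    partialDeriv 1 (fun y => v y 1) x,
    partialDeriv 1 (fun y => v y 0) x + partialDeriv 0 (fun y => v y 1) x]

/-- The strain energy density `ε(v)ᵀ C ε(u)`. -/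
def energyDensity (C : Matrix (Fin 3) (Fin 3) ℝ) (u v : VecField) (x : Plane) : ℝ :=
  strain v x ⬝ᵥ (C *ᵥ strain u x)

/-- The bilinear form `a_E(u, v) = ∫_E ε(v)ᵀ C ε(u) dE`. -/
def energy {n : ℕ} (P : Polygon Plane n) (C : Matrix (Fin 3) (Fin 3) ℝ) (u v : VecField) : ℝ :=
  ∫ x in element P, energyDensity C u v x

/-! ### The polynomial basis of degree one -/

/-- The scaled monomial `ξ` (for `d = 0`) or `η` (for `d = 1`). -/
def scaledCoord {n : ℕ} (P : Polygon Plane n) (d : Fin 2) (x : Plane) : ℝ :=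
  (x d - centroid P d) / elementDiam P

/-- The basis `p₁, …, p₆` of the vector polynomials of degree at most one; the first three are the
infinitesimal rigid body motions. -/
def polyBasis {n : ℕ} (P : Polygon Plane n) (α : Fin 6) : VecField := fun x =>
  let ξ := scaledCoord P 0 x
  let η := scaledCoord P 1 x
  (![![1, 0], ![0, 1], ![-η, ξ], ![η, ξ], ![ξ, 0], ![0, η]] : Fin 6 → Fin 2 → ℝ) α

/-! ### Virtual element functions of order one -/

/-- Membership in the scalar virtual element space of order `k = 1` on `E`: `f` is continuous on the
closed element, affine along each edge, has Laplacian zero in `E` (a polynomial of degree `k - 2`),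
and is square integrable on `E` together with its first derivatives. Harmonic functions are smooth,
so the classical derivative is the weak one. -/
structure IsVEMFunction {n : ℕ} (P : Polygon Plane n) (f : Plane → ℝ) : Prop where
  continuousOn : ContinuousOn f (closure (element P))
  affine_edge : ∀ j : Fin n, ∃ a b : ℝ, ∀ t ∈ Set.Icc (0 : ℝ) 1, f (P.edgePath ℝ j t) = a + b * t
  harmonic : HarmonicOnNhd f (element P)
  memLp : MemLp f 2 (volume.restrict (element P))
  memLp_fderiv : MemLp (fderiv ℝ f) 2 (volume.restrict (element P))

/-- `φ₁, …, φₙ` are the virtual element basis functions: they belong to the virtual element space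
and have the Kronecker delta property at the vertices. -/
structure IsVEMBasis {n : ℕ} (P : Polygon Plane n) (φ : Fin n → Plane → ℝ) : Prop where
  mem : ∀ j, IsVEMFunction P (φ j)
  kronecker : ∀ i j, φ j (P.vertices i) = if i = j then 1 else 0

/-- The index set of the `2 n` degrees of freedom of an element with `n` vertices: `(j, 0)` and
`(j, 1)` are the two displacement unknowns at vertex `j`. -/
abbrev Dof (n : ℕ) : Type := Fin n × Fin 2

/-- The value of a vector field at a degree of freedom. -/
def dof {n : ℕ} (P : Polygon Plane n) (i : Dof n) (v : VecField) : ℝ :=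
  v (P.vertices i.1) i.2

/-- The vector basis functions: `(φⱼ, 0)` at the index `(j, 0)` and `(0, φⱼ)` at `(j, 1)`. -/
def vecBasis {n : ℕ} (φ : Fin n → Plane → ℝ) (i : Dof n) : VecField := fun x =>
  Pi.single i.2 (φ i.1 x)

/-! ### The matrices -/

/-- `D_{iα} = dof_i(p_α)`. -/
def matD {n : ℕ} (P : Polygon Plane n) : Matrix (Dof n) (Fin 6) ℝ :=
  Matrix.of fun i α => dof P i (polyBasis P α)

/-- The modified matrix `B̄`: vertex averages in the three rigid body rows, `a_E(p_α, φ_I)` in the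
other rows. -/
def matBbar {n : ℕ} (P : Polygon Plane n) (C : Matrix (Fin 3) (Fin 3) ℝ)
    (φ : Fin n → Plane → ℝ) : Matrix (Fin 6) (Dof n) ℝ :=
  Matrix.of fun α I =>
    if α.val < 3 then
      1 / (n : ℝ) * ∑ i : Dof n, dof P i (vecBasis φ I) * dof P i (polyBasis P α)
    else energy P C (polyBasis P α) (vecBasis φ I)

/-- The modified matrix `G`: vertex averages in the three rigid body rows, `a_E(p_α, p_β)` in the
other rows. -/
def matG {n : ℕ} (P : Polygon Plane n) (C : Matrix (Fin 3) (Fin 3) ℝ) :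
    Matrix (Fin 6) (Fin 6) ℝ :=
  Matrix.of fun α β =>
    if α.val < 3 then
      1 / (n : ℝ) * ∑ i : Dof n, dof P i (polyBasis P α) * dof P i (polyBasis P β)
    else energy P C (polyBasis P α) (polyBasis P β)

end VEM

end

/-!
A field with affine components is reproduced by the virtual element basis: on the element `E`,
`p_β = ∑_I dof_I(p_β) φ_I`. On each edge both sides are affine with the same values at the two end
points, so they agree on the polygon. Since `E` is open and bounded and its frontier lies on the
polygon, and both sides are harmonic in `E`, they agree in `E` by the maximum principle
(`InnerProductSpace.HarmonicOnNhd.eqOn_zero_of_frontier`, `VEM.IsVEMBasis.sum_vertices_eq`).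

Differentiating this identity and inserting it into the second argument of `a_E` gives the elastic
rows of `B̄ D = G`; the integral commutes with the finite sum because the strain of `p_α` is constant
and that of `φ_I` is square integrable over a set of finite area. In the rigid body rows the
identity is the Kronecker property `dof_i(φ_I) = δ_{iI}`.
-/

open Topology

/-! ### The maximum principle for harmonic functions -/

theorem IsLocalMax.deriv_deriv_nonpos {g : ℝ → ℝ} {a : ℝ} (h : IsLocalMax g a)
    (hg : ContinuousAt g a) : deriv (deriv g) a ≤ 0 := by
  by_contra! hpos
  -- A point that is both a local maximum and a local minimum has a neighbourhood on which `g` is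
  -- constant, and there the second derivative vanishes.
  have hmin : IsLocalMin g a := isLocalMin_of_deriv_deriv_pos hpos h.deriv_eq_zero hg
  have hconst : g =ᶠ[𝓝 a] fun _ => g a := by
    filter_upwards [h, hmin] with t h1 h2 using le_antisymm h1 h2
  have : deriv (deriv g) a = 0 := by
    rw [hconst.deriv.deriv_eq]
    simp
  exact hpos.ne' this

section MaximumPrinciple

variable {V : Type*} [NormedAddCommGroup V] [InnerProductSpace ℝ V]

/-- The second derivative test in a fixed direction: at a local maximum of `f + ε ‖·‖²` the second
derivative of `f` along a unit vector is at most `-2 ε`. -/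
theorem IsLocalMax.iteratedFDeriv_two_le {f : V → ℝ} {x v : V} {ε : ℝ} (hv : ‖v‖ = 1)
    (hf : ContDiffAt ℝ 2 f x) (h : IsLocalMax (fun y => f y + ε * ‖y‖ ^ 2) x) :
    iteratedFDeriv ℝ 2 f x ![v, v] ≤ -2 * ε := by
  set γ : ℝ → V := fun t => x + t • v with hγ
  have hγ0 : γ 0 = x := by simp [hγ]
  have hγc : Continuous γ := by fun_prop
  have hγd : ∀ t, HasDerivAt γ v t := fun t => by
    simpa [hγ] using ((hasDerivAt_id t).smul_const v).const_add x
  have hγt : Filter.Tendsto γ (𝓝 0) (𝓝 x) := by simpa [hγ0] using hγc.tendsto 0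
  set g : ℝ → ℝ := fun t => f (γ t) + ε * ‖γ t‖ ^ 2 with hg
  have hmax : IsLocalMax g 0 := by
    have := hγt.eventually h
    filter_upwards [this] with t ht
    simpa [hg, hγ0] using ht
  have hsq : ∀ t, HasDerivAt (fun s => ε * ‖γ s‖ ^ 2) (ε * (2 * inner ℝ (γ t) v)) t := fun t =>
    ((hγd t).norm_sq).const_mul ε
  have hd : deriv g =ᶠ[𝓝 0] fun t => fderiv ℝ f (γ t) v + ε * (2 * inner ℝ (γ t) v) := by
    have hev : ∀ᶠ y in 𝓝 x, DifferentiableAt ℝ f y := by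
      filter_upwards [hf.eventually (by simp)] with y hy using hy.differentiableAt (by simp)
    filter_upwards [hγt.eventually hev] with t ht
    exact ((ht.hasFDerivAt.comp_hasDerivAt t (hγd t)).add (hsq t)).deriv
  have hdd : deriv (deriv g) 0 = fderiv ℝ (fderiv ℝ f) x v v + ε * 2 := by
    rw [hd.deriv_eq]
    have h1 : HasFDerivAt (fderiv ℝ f) (fderiv ℝ (fderiv ℝ f) x) (γ 0) := by
      rw [hγ0]
      exact ((hf.fderiv_right (m := 1) (by norm_num)).differentiableAt (by simp)).hasFDerivAt
    have h2 : HasDerivAt (fun t => fderiv ℝ f (γ t) v) (fderiv ℝ (fderiv ℝ f) x v v) 0 :=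
      ((ContinuousLinearMap.apply ℝ ℝ v).hasFDerivAt.comp_hasDerivAt 0
        (h1.comp_hasDerivAt 0 (hγd 0)))
    have h3 : HasDerivAt (fun t => ε * (2 * inner ℝ (γ t) v)) (ε * 2) 0 := by
      have := (((hγd 0).inner ℝ (hasDerivAt_const 0 v)).const_mul 2).const_mul ε
      simpa [real_inner_self_eq_norm_sq, hv] using this
    exact (h2.add h3).deriv
  have hgc : ContinuousAt g 0 := by
    have : ContinuousAt (fun t => f (γ t)) 0 :=
      ContinuousAt.comp (by rw [hγ0]; exact hf.continuousAt) hγc.continuousAt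
    exact this.add (by fun_prop)
  have := hmax.deriv_deriv_nonpos hgc
  rw [hdd] at this
  rw [iteratedFDeriv_two_apply]
  simp only [Matrix.cons_val_zero, Matrix.cons_val_one]
  linarith

variable [FiniteDimensional ℝ V]

theorem InnerProductSpace.harmonicAt_clm_add_const (L : V →L[ℝ] ℝ) (c : ℝ) (x : V) :
    HarmonicAt (fun y => L y + c) x := by
  refine ⟨by fun_prop, Filter.Eventually.of_forall fun y => ?_⟩
  have : fderiv ℝ (fun y => L y + c) = fun _ => L := by
    ext1 z
    simp
  simp [laplacian_eq_iteratedFDeriv_stdOrthonormalBasis, iteratedFDeriv_two_apply, this]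

variable [Nontrivial V]

/-- The weak maximum principle: a harmonic function on a bounded open set that is continuous up to
the boundary and nonpositive there is nonpositive. -/
theorem InnerProductSpace.HarmonicOnNhd.nonpos_of_frontier {U : Set V} {f : V → ℝ} (hU : IsOpen U)
    (hb : Bornology.IsBounded U) (hc : ContinuousOn f (closure U)) (hf : HarmonicOnNhd f U)
    (hfr : ∀ x ∈ frontier U, f x ≤ 0) {x : V} (hx : x ∈ U) : f x ≤ 0 := by
  have hcpt : IsCompact (closure U) := hb.isCompact_closure
  obtain ⟨R, hR⟩ := hcpt.isBounded.exists_norm_le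
  -- Adding `ε ‖·‖²` makes the Laplacian positive, which excludes an interior maximum.
  have key : ∀ ε > 0, f x ≤ ε * R ^ 2 := by
    intro ε hε
    have hgc : ContinuousOn (fun y => f y + ε * ‖y‖ ^ 2) (closure U) :=
      hc.add (by fun_prop)
    obtain ⟨z, hz, hzmax⟩ := hcpt.exists_isMaxOn ⟨x, subset_closure hx⟩ hgc
    have hxz : f x + ε * ‖x‖ ^ 2 ≤ f z + ε * ‖z‖ ^ 2 := hzmax (subset_closure hx)
    by_cases hzU : z ∈ U
    · exfalso
      have hloc : IsLocalMax (fun y => f y + ε * ‖y‖ ^ 2) z :=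
        hzmax.isLocalMax (Filter.mem_of_superset (hU.mem_nhds hzU) subset_closure)
      have hlap : ∑ i, iteratedFDeriv ℝ 2 f z
          ![(stdOrthonormalBasis ℝ V) i, (stdOrthonormalBasis ℝ V) i] = 0 := by
        have := (hf z hzU).2.self_of_nhds
        rwa [laplacian_eq_iteratedFDeriv_stdOrthonormalBasis] at this
      have hne : (Finset.univ : Finset (Fin (Module.finrank ℝ V))).Nonempty :=
        ⟨⟨0, Module.finrank_pos⟩, Finset.mem_univ _⟩
      have hneg := Finset.sum_lt_sum_of_nonempty hne (g := fun _ => (0 : ℝ)) fun i _ =>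
        (hloc.iteratedFDeriv_two_le ((stdOrthonormalBasis ℝ V).norm_eq_one i)
          (hf z hzU).1).trans_lt (show -2 * ε < 0 by linarith)
      rw [hlap] at hneg
      simp at hneg
    · have hzf : f z ≤ 0 := hfr z (by rw [hU.frontier_eq]; exact ⟨hz, hzU⟩)
      have hzR : ‖z‖ ^ 2 ≤ R ^ 2 := pow_le_pow_left₀ (norm_nonneg z) (hR z hz) 2
      have h1 := mul_le_mul_of_nonneg_left hzR hε.le
      have h2 : 0 ≤ ε * ‖x‖ ^ 2 := by positivity
      linarith
  refine le_of_forall_pos_le_add fun δ hδ => ?_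
  have hpos : 0 < R ^ 2 + 1 := by positivity
  refine (key (δ / (R ^ 2 + 1)) (by positivity)).trans ?_
  rw [zero_add, div_mul_eq_mul_div, div_le_iff₀ hpos]
  nlinarith

/-- Uniqueness for the Dirichlet problem on a bounded open set. -/
theorem InnerProductSpace.HarmonicOnNhd.eqOn_zero_of_frontier {U : Set V} {f : V → ℝ} (hU : IsOpen U)
    (hb : Bornology.IsBounded U) (hc : ContinuousOn f (closure U)) (hf : HarmonicOnNhd f U)
    (hfr : ∀ x ∈ frontier U, f x = 0) : Set.EqOn f 0 U := fun x hx => by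
  refine le_antisymm (nonpos_of_frontier hU hb hc hf (fun y hy => (hfr y hy).le) hx) ?_
  have := nonpos_of_frontier hU hb hc.neg hf.neg (fun y hy => by simp [hfr y hy]) hx
  simpa using this

end MaximumPrinciple

namespace VEM

variable {n : ℕ} (P : Polygon Plane n)

/-! ### Topology of the element -/

theorem isCompact_boundary : IsCompact (P.boundary ℝ) :=
  isCompact_iUnion fun j => by
    rw [Polygon.edgeSet_eq_image_edgePath]
    exact isCompact_Icc.image (P.edgePath ℝ j).continuous_of_finiteDimensional

theorem isOpen_compl_boundary : IsOpen (P.boundary ℝ)ᶜ :=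
  (isCompact_boundary P).isClosed.isOpen_compl

theorem connectedComponentIn_subset_element {x : Plane} (hx : x ∈ element P) :
    connectedComponentIn (P.boundary ℝ)ᶜ x ⊆ element P := fun y hy =>
  ⟨connectedComponentIn_subset _ _ hy, by
    rw [← connectedComponentIn_eq hy]
    exact hx.2⟩

theorem isOpen_element : IsOpen (element P) :=
  isOpen_iff_mem_nhds.2 fun _ hx => Filter.mem_of_superset
    ((isOpen_compl_boundary P).connectedComponentIn.mem_nhds (mem_connectedComponentIn hx.1))
    (connectedComponentIn_subset_element P hx)

theorem frontier_element_subset : frontier (element P) ⊆ P.boundary ℝ := by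
  intro x hx
  rw [(isOpen_element P).frontier_eq] at hx
  by_contra hxb
  -- The component of `x` is a neighbourhood of `x`, so it meets `E`, and it is then part of `E`.
  have hnhds : connectedComponentIn (P.boundary ℝ)ᶜ x ∈ 𝓝 x :=
    (isOpen_compl_boundary P).connectedComponentIn.mem_nhds (mem_connectedComponentIn hxb)
  obtain ⟨y, hyc, hyE⟩ := mem_closure_iff_nhds.1 hx.1 _ hnhds
  refine hx.2 (connectedComponentIn_subset_element P hyE ?_)
  rw [← connectedComponentIn_eq hyc]
  exact mem_connectedComponentIn hxb

/-- A point farther from the origin than the whole polygon is joined to infinity by a radial ray in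
the complement, so its component is unbounded. -/
theorem isBounded_element : Bornology.IsBounded (element P) := by
  obtain ⟨R, hRpos, hR⟩ := (isCompact_boundary P).isBounded.exists_pos_norm_le
  refine isBounded_iff_forall_norm_le.2 ⟨R, fun x hx => ?_⟩
  by_contra! hxR
  have hx0 : 0 < ‖x‖ := hRpos.trans hxR
  set S : Set Plane := (fun t : ℝ => t • x) '' Set.Ici 1
  have hSc : IsPreconnected S :=
    isPreconnected_Ici.image _ (by fun_prop)
  have hS : S ⊆ connectedComponentIn (P.boundary ℝ)ᶜ x := by
    refine hSc.subset_connectedComponentIn ⟨1, Set.self_mem_Ici, one_smul ℝ x⟩ ?_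
    rintro _ ⟨t, ht, rfl⟩ hmem
    have h1 : ‖t • x‖ ≤ R := hR _ hmem
    have ht1 : (1 : ℝ) ≤ t := ht
    rw [norm_smul, Real.norm_eq_abs, abs_of_nonneg (by linarith)] at h1
    nlinarith
  obtain ⟨K, hK⟩ := isBounded_iff_forall_norm_le.1 (hx.2.subset hS)
  have hKs := hK (max 1 ((K + 1) / ‖x‖) • x) ⟨_, Set.mem_Ici.2 (le_max_left _ _), rfl⟩
  rw [norm_smul, Real.norm_eq_abs, abs_of_nonneg (by positivity)] at hKs
  have := mul_le_mul_of_nonneg_right (le_max_right 1 ((K + 1) / ‖x‖)) hx0.le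
  rw [div_mul_cancel₀ _ hx0.ne'] at this
  linarith

theorem volume_element_lt_top : volume (element P) < ⊤ :=
  (isBounded_element P).measure_lt_top

/-! ### Reproduction of affine functions -/

variable {P} {φ : Fin n → Plane → ℝ}

theorem IsVEMBasis.sum_edgePath_eq (hφ : IsVEMBasis P φ) (L : Plane →L[ℝ] ℝ) (c : ℝ)
    (k : Fin n) {t : ℝ} (ht : t ∈ Set.Icc (0 : ℝ) 1) :
    ∑ j, (L (P.vertices j) + c) * φ j (P.edgePath ℝ k t) = L (P.edgePath ℝ k t) + c := by
  have hφe : ∀ j, φ j (P.edgePath ℝ k t) =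
      (1 - t) * (if k = j then 1 else 0) + t * (if finRotate n k = j then 1 else 0) := by
    intro j
    obtain ⟨a, b, hab⟩ := (hφ.mem j).affine_edge k
    have h0 := hab 0 (by simp)
    have h1 := hab 1 (by simp)
    simp only [Polygon.edgePath, AffineMap.lineMap_apply_zero, AffineMap.lineMap_apply_one,
      hφ.kronecker] at h0 h1
    rw [hab t ht, h0, h1]
    ring
  simp_rw [hφe, mul_add, Finset.sum_add_distrib]
  simp only [Polygon.edgePath, AffineMap.lineMap_apply_module, map_add, map_smul, smul_eq_mul,
    mul_ite, mul_one, mul_zero, Finset.sum_ite_eq, Finset.mem_univ, if_true]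
  ring

theorem IsVEMBasis.sum_vertices_eq (hφ : IsVEMBasis P φ) (L : Plane →L[ℝ] ℝ) (c : ℝ)
    {x : Plane} (hx : x ∈ element P) :
    ∑ j, (L (P.vertices j) + c) * φ j x = L x + c := by
  set f : Plane → ℝ := fun y => (∑ j, (L (P.vertices j) + c) * φ j y) - (L y + c)
  have hcont : ContinuousOn f (closure (element P)) :=
    (continuousOn_finsetSum _ fun j _ => continuousOn_const.mul (hφ.mem j).continuousOn).sub
      (L.continuous.add continuous_const).continuousOn
  have hsum : ∀ s : Finset (Fin n),
      HarmonicOnNhd (fun y => ∑ j ∈ s, (L (P.vertices j) + c) * φ j y) (element P) := by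
    intro s
    induction s using Finset.induction_on with
    | empty => simp
    | insert j s hj ih =>
      simp_rw [Finset.sum_insert hj]
      exact ((hφ.mem j).harmonic.const_smul (c := L (P.vertices j) + c)).add ih
  have hharm : HarmonicOnNhd f (element P) :=
    (hsum Finset.univ).sub fun y _ => harmonicAt_clm_add_const L c y
  have hfr : ∀ y ∈ frontier (element P), f y = 0 := by
    intro y hy
    obtain ⟨k, hk⟩ := Set.mem_iUnion.1 (frontier_element_subset P hy)
    rw [Polygon.edgeSet_eq_image_edgePath] at hk
    obtain ⟨t, ht, rfl⟩ := hk
    exact sub_eq_zero.2 (hφ.sum_edgePath_eq L c k ht)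
  exact sub_eq_zero.1 (HarmonicOnNhd.eqOn_zero_of_frontier (isOpen_element P)
    (isBounded_element P) hcont hharm hfr hx)

/-! ### Strains of the polynomial and of the virtual basis -/

variable (P) in
theorem exists_scaledCoord_eq (d : Fin 2) :
    ∃ (L : Plane →L[ℝ] ℝ) (c : ℝ), ∀ x, scaledCoord P d x = L x + c :=
  ⟨(elementDiam P)⁻¹ • EuclideanSpace.proj d, -(centroid P d / elementDiam P), fun x => by
    simp [scaledCoord]
    ring⟩

variable (P) in
theorem exists_polyBasis_eq (α : Fin 6) (d : Fin 2) :
    ∃ (L : Plane →L[ℝ] ℝ) (c : ℝ), ∀ x, polyBasis P α x d = L x + c := by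
  obtain ⟨L, c, hξ⟩ := exists_scaledCoord_eq P 0
  obtain ⟨M, e, hη⟩ := exists_scaledCoord_eq P 1
  have hconst : ∀ r : ℝ, ∃ (L : Plane →L[ℝ] ℝ) (c : ℝ), ∀ x, r = L x + c :=
    fun r => ⟨0, r, fun x => by simp⟩
  have hneg : ∃ (L : Plane →L[ℝ] ℝ) (c : ℝ), ∀ x, -scaledCoord P 1 x = L x + c :=
    ⟨-M, -e, fun x => by simp [hη]; ring⟩
  fin_cases α <;> fin_cases d
  exacts [hconst 1, hconst 0, hconst 0, hconst 1, hneg, ⟨L, c, hξ⟩, ⟨M, e, hη⟩, ⟨L, c, hξ⟩,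
    ⟨L, c, hξ⟩, hconst 0, hconst 0, ⟨M, e, hη⟩]

variable (P) in
theorem exists_strain_polyBasis_eq (α : Fin 6) : ∃ s, ∀ x, strain (polyBasis P α) x = s := by
  obtain ⟨L, c, hL⟩ := exists_polyBasis_eq P α 0
  obtain ⟨M, e, hM⟩ := exists_polyBasis_eq P α 1
  refine ⟨strain (polyBasis P α) 0, fun x => ?_⟩
  simp only [strain, partialDeriv, hL, hM, fderiv_add_const, ContinuousLinearMap.fderiv]

theorem partialDeriv_vecBasis (I : Dof n) (d k : Fin 2) (x : Plane) :
    partialDeriv d (fun y => vecBasis φ I y k) x =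
      if I.2 = k then partialDeriv d (φ I.1) x else 0 := by
  split_ifs with h
  · subst h
    simp [vecBasis]
  · simp [vecBasis, Ne.symm h, partialDeriv]

theorem IsVEMBasis.partialDeriv_polyBasis (hφ : IsVEMBasis P φ) (β : Fin 6) (d k : Fin 2)
    {x : Plane} (hx : x ∈ element P) :
    partialDeriv d (fun y => polyBasis P β y k) x =
      ∑ I : Dof n, dof P I (polyBasis P β) * partialDeriv d (fun y => vecBasis φ I y k) x := by
  obtain ⟨L, c, hL⟩ := exists_polyBasis_eq P β k
  have hev : (fun y => polyBasis P β y k) =ᶠ[𝓝 x]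
      fun y => ∑ j, polyBasis P β (P.vertices j) k * φ j y := by
    filter_upwards [(isOpen_element P).mem_nhds hx] with y hy
    simp only [hL]
    exact (hφ.sum_vertices_eq L c hy).symm
  have hdiff : ∀ j, DifferentiableAt ℝ (φ j) x := fun j =>
    ((hφ.mem j).harmonic x hx).1.differentiableAt (by simp)
  simp_rw [partialDeriv_vecBasis, Fintype.sum_prod_type]
  rw [partialDeriv, hev.fderiv_eq, fderiv_fun_sum fun j _ => (hdiff j).const_mul _]
  simp [fderiv_const_mul (hdiff _), partialDeriv, dof]

theorem IsVEMBasis.strain_polyBasis (hφ : IsVEMBasis P φ) (β : Fin 6)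
    {x : Plane} (hx : x ∈ element P) :
    strain (polyBasis P β) x =
      ∑ I : Dof n, dof P I (polyBasis P β) • strain (vecBasis φ I) x := by
  ext k
  fin_cases k <;>
    simp [strain, hφ.partialDeriv_polyBasis β _ _ hx, mul_add, Finset.sum_add_distrib]

theorem IsVEMBasis.energyDensity_polyBasis (hφ : IsVEMBasis P φ) (C : Matrix (Fin 3) (Fin 3) ℝ)
    (u : VecField) (β : Fin 6) {x : Plane} (hx : x ∈ element P) :
    energyDensity C u (polyBasis P β) x =
      ∑ I : Dof n, energyDensity C u (vecBasis φ I) x * dof P I (polyBasis P β) := by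
  simp only [energyDensity, hφ.strain_polyBasis β hx, sum_dotProduct, smul_dotProduct,
    smul_eq_mul, mul_comm]

/-! ### Convergence of the energy integrals -/

theorem integrableOn_energyDensity_polyBasis (C : Matrix (Fin 3) (Fin 3) ℝ) (α β : Fin 6) :
    IntegrableOn (energyDensity C (polyBasis P α) (polyBasis P β)) (element P) := by
  obtain ⟨s, hs⟩ := exists_strain_polyBasis_eq P α
  obtain ⟨t, ht⟩ := exists_strain_polyBasis_eq P β
  have : energyDensity C (polyBasis P α) (polyBasis P β) = fun _ => t ⬝ᵥ (C *ᵥ s) := by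
    ext x
    simp [energyDensity, hs, ht]
  rw [this]
  exact integrableOn_const (volume_element_lt_top P).ne

theorem IsVEMFunction.integrableOn_partialDeriv {f : Plane → ℝ} (hf : IsVEMFunction P f)
    (d : Fin 2) : IntegrableOn (partialDeriv d f) (element P) := by
  have : IsFiniteMeasure (volume.restrict (element P)) :=
    ⟨by simpa using volume_element_lt_top P⟩
  exact (hf.memLp_fderiv.integrable (by norm_num)).apply_continuousLinearMap _

theorem IsVEMBasis.integrableOn_energyDensity_vecBasis (hφ : IsVEMBasis P φ)
    (C : Matrix (Fin 3) (Fin 3) ℝ) (α : Fin 6) (I : Dof n) :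
    IntegrableOn (energyDensity C (polyBasis P α) (vecBasis φ I)) (element P) := by
  obtain ⟨s, hs⟩ := exists_strain_polyBasis_eq P α
  have hpart : ∀ d k : Fin 2,
      IntegrableOn (fun x => partialDeriv d (fun y => vecBasis φ I y k) x) (element P) := by
    intro d k
    simp_rw [partialDeriv_vecBasis]
    split_ifs
    · exact (hφ.mem I.1).integrableOn_partialDeriv d
    · exact integrableOn_zero
  have hstrain : ∀ k, IntegrableOn (fun x => strain (vecBasis φ I) x k) (element P) := by
    intro k
    fin_cases k
    exacts [hpart 0 0, hpart 1 1, (hpart 1 0).add (hpart 0 1)]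
  have : energyDensity C (polyBasis P α) (vecBasis φ I) =
      fun x => ∑ k, strain (vecBasis φ I) x k * (C *ᵥ s) k := by
    ext x
    simp only [energyDensity, hs, dotProduct]
  rw [this]
  exact integrable_finsetSum _ fun k _ => (hstrain k).mul_const _

/-! ### The matrix identity -/

theorem IsVEMBasis.dof_vecBasis (hφ : IsVEMBasis P φ) (i I : Dof n) :
    dof P i (vecBasis φ I) = if i = I then 1 else 0 := by
  obtain ⟨i, d⟩ := i
  obtain ⟨j, e⟩ := I
  by_cases h1 : i = j <;> by_cases h2 : d = e <;>
    simp [dof, vecBasis, hφ.kronecker, h1, h2]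

theorem IsVEMBasis.matBbar_mul_matD (hφ : IsVEMBasis P φ) (C : Matrix (Fin 3) (Fin 3) ℝ) :
    matBbar P C φ * matD P = matG P C := by
  ext α β
  simp only [mul_apply, matBbar, matD, matG, of_apply]
  split_ifs
  · simp only [hφ.dof_vecBasis, ite_mul, one_mul, zero_mul, Finset.sum_ite_eq', Finset.mem_univ,
      if_true, mul_assoc, Finset.mul_sum]
  · simp only [energy]
    rw [setIntegral_congr_fun (isOpen_element P).measurableSet
      fun x hx => hφ.energyDensity_polyBasis C (polyBasis P α) β hx,
      integral_finsetSum _ fun I _ =>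
        (hφ.integrableOn_energyDensity_vecBasis C α I).mul_const _]
    simp only [integral_mul_const]

end VEM

/-- For the lowest-order virtual element on a simple polygon, `B̄ D = G`; moreover all the energy
integrals that enter `B̄` and `G` converge. -/
theorem mainTheorem1 {n : ℕ} (P : Polygon VEM.Plane n) (hP : VEM.IsSimple P)
    (C : Matrix (Fin 3) (Fin 3) ℝ)
    (φ : Fin n → VEM.Plane → ℝ) (hφ : VEM.IsVEMBasis P φ) :
    (∀ (α : Fin 6) (i : VEM.Dof n),
        MeasureTheory.IntegrableOn
          (VEM.energyDensity C (VEM.polyBasis P α) (VEM.vecBasis φ i)) (VEM.element P)) ∧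
      (∀ α β : Fin 6,
        MeasureTheory.IntegrableOn
          (VEM.energyDensity C (VEM.polyBasis P α) (VEM.polyBasis P β)) (VEM.element P)) ∧
      VEM.matBbar P C φ * VEM.matD P = VEM.matG P C :=
  ⟨hφ.integrableOn_energyDensity_vecBasis C, VEM.integrableOn_energyDensity_polyBasis C,
    hφ.matBbar_mul_matD C⟩
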